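/- **Marked interval orders.** A marked interval is a compact interval of $\mathbf R$ with finitely many marked points, all strictly to the right of its left endpoint. Two embeddings of $n$ marked intervals, labeled $1,\dots,n$, are equivalent if for all $a,b$ the number $w(a,b)$ of marked points of the $a$-th interval lying to the left of the left endpoint of the $b$-th one is the same in both; an equivalence class (i.e. a table $w$) is a labeled marked interval order. Two of them are isomorphic if they differ by a renaming of the labels; an unlabeled marked interval order is an isomorphism class. Elements $i\neq j$ are exchangeable if $w(i,j)=w(j,i)=0$ and $w(i,k)=w(j,k)$, $w(k,i)=w(k,j)$ for all $k$. Prescribe the length of the $j$-th interval and the finite set $L_j\subset(0,\infty)$ of the distances of its marks from its left endpoint. Let $O_n$ be the set of labeled marked interval orders obtained from $n$ intervals of these shapes placed at arbitrary positions $x_1,\dots,x_n\in\mathbf R$, let $A_n(O)$ be the arrangement in $\mathbf R^n$ of all hyperplanes $x_i-x_j=l$ with $i\ne j$, $l\in L_j$, and let $B_n$ be the braid arrangement of all hyperplanes $x_i=x_j$, $i\neq j$. Regions are the connected components of the complement of the union of the hyperplanes. 1. For every $n$ and all lengths and sets $L_1,\dots,L_n$ (they may differ from interval to interval), $O_n$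 is finite, and sending a region of $A_n(O)$ to the labeled marked interval order of any of its points is a well-defined bijection from the regions of $A_n(O)$ onto $O_n$. 2. Let lengths and $L_1,L_2,L_3,\dots$ be such that the family $O=(O_n)_{n\ge0}$ (where $O_n$ uses the first $n$ intervals) is a family of labeled structures in the usual sense, that is, every relabeling of a member of $O_n$ is a member of $O_n$, for every $n$ (for instance, all intervals are marked in the same way). Then for every $n$, sending a region of $A_n(O)\cup B_n$ to the unlabeled marked interval order of any of its points is a well-defined map onto the unlabeled members of $O_n$, and each unlabeled member has exactly $n!$ preimages. Moreover $E(x)=\sum_n |O_n|\,x^n/n!$ and $O(x)=\sum_n o_n x^n$, where $o_n$ is the number of unlabeled members of $O_n$, satisfy $E(x)=O(1-e^{-x})$ as formal power series. 3. More generally, let $O=(O_n)_{n\ge0}$, with each $O_n$ a finite set of labeled marked interval orders on $n$ elements (the intervals may be marked differently), be a garden: it is closed under relabeling, under adding an element exchangeable with a given one, and under removing an element exchangeable with another one. Then its generating functions, defined as in 2, satisfy $E(x)=O(1-e^{-x})$. -/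

import Mathlib

namespace MarkedIntervalOrder

noncomputable section

/-- A compact interval `[left, right]` of the real line with finitely many marked points, all of
them strictly to the right of the left endpoint (which is thus not itself marked). -/
structure MarkedInterval where
  left : ℝ
  right : ℝ
  left_le_right : left ≤ right
  marks : Finset ℝ
  marks_mem : ∀ m ∈ marks, m ∈ Set.Ioc left right

/-- An interval considered up to translation: its length, and the distances of its marked points
from its left endpoint. -/
structure Shape where
  length : ℝ
  length_nonneg : 0 ≤ length
  offsets : Finset ℝ
  offsets_mem : ∀ l ∈ offsets, l ∈ Set.Ioc 0 length

/-- The marked interval of shape `s` whose left endpoint is `x`. -/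
def Shape.place (s : Shape) (x : ℝ) : MarkedInterval where
  left := x
  right := x + s.length
  left_le_right := by linarith [s.length_nonneg]
  marks := s.offsets.image (fun l => x + l)
  marks_mem := by
    intro m hm
    obtain ⟨l, hl, rfl⟩ := Finset.mem_image.1 hm
    obtain ⟨h1, h2⟩ := s.offsets_mem l hl
    exact ⟨by linarith, by linarith⟩

/-- The number of marked points of `I` to the left of the leftmost point of `J`. -/
def marksBefore (I J : MarkedInterval) : ℕ :=
  (I.marks.filter (fun m => m < J.left)).card

/-- Two embeddings of `n` labeled marked intervals are equivalent iff they have the same table of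
numbers `marksBefore (I a) (I b)`; so an equivalence class is recorded by that table. (Its diagonal
entries are all zero.) -/
def orderOfIntervals {n : ℕ} (I : Fin n → MarkedInterval) : Fin n → Fin n → ℕ :=
  fun a b => marksBefore (I a) (I b)

/-- `w` is (the table of) a labeled marked interval order on `n` intervals. -/
def IsMarkedIntervalOrder {n : ℕ} (w : Fin n → Fin n → ℕ) : Prop :=
  ∃ I : Fin n → MarkedInterval, orderOfIntervals I = w

/-- The marked interval order of the intervals of shapes `S j` placed at the points `x j`. -/
def orderAt {n : ℕ} (S : Fin n → Shape) (x : Fin n → ℝ) : Fin n → Fin n → ℕ :=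
  orderOfIntervals (fun j => (S j).place (x j))

/-- The labeled marked interval orders of `n` intervals in which interval `j` has shape `S j`. -/
def labeledMembers {n : ℕ} (S : Fin n → Shape) : Set (Fin n → Fin n → ℕ) :=
  Set.range (orderAt S)

/-- The first `n` shapes of a sequence of shapes. -/
def firstShapes (S : ℕ → Shape) (n : ℕ) : Fin n → Shape :=
  fun j => S j

/-! Labeled and unlabeled structures -/

/-- Renaming the labels: label `i` of the new structure is label `σ i` of the old one. -/
def relabel {n : ℕ} (σ : Equiv.Perm (Fin n)) (w : Fin n → Fin n → ℕ) : Fin n → Fin n → ℕ :=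
  fun a b => w (σ a) (σ b)

/-- Isomorphism of labeled structures: they differ by a renaming of the labels. -/
def isoSetoid (n : ℕ) : Setoid (Fin n → Fin n → ℕ) where
  r w w' := ∃ σ : Equiv.Perm (Fin n), relabel σ w = w'
  iseqv :=
    { refl := fun w => ⟨1, rfl⟩
      symm := by
        rintro w _ ⟨σ, rfl⟩
        exact ⟨σ⁻¹, by funext a b; simp [relabel]⟩
      trans := by
        rintro w _ _ ⟨σ, rfl⟩ ⟨τ, rfl⟩
        exact ⟨σ * τ, by funext a b; simp [relabel]⟩ }

/-- The unlabeled structure underlying a labeled one: its isomorphism class. -/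
def unlabel {n : ℕ} (w : Fin n → Fin n → ℕ) : Quotient (isoSetoid n) :=
  Quotient.mk (isoSetoid n) w

/-- `O n` is the set of labeled members with label set `Fin n`; this says that every labeling of
the structure underlying a labeled member is again a labeled member. -/
def RelabelingClosed (O : (n : ℕ) → Set (Fin n → Fin n → ℕ)) : Prop :=
  ∀ (n : ℕ) (w : Fin n → Fin n → ℕ), w ∈ O n →
    ∀ σ : Equiv.Perm (Fin n), relabel σ w ∈ O n

/-- The exponential generating function of the labeled members. -/
def egf (O : (n : ℕ) → Set (Fin n → Fin n → ℕ)) : PowerSeries ℚ :=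
  PowerSeries.mk fun n => ((O n).ncard : ℚ) / (n.factorial : ℚ)

/-- The ordinary generating function of the unlabeled members. -/
def ogf (O : (n : ℕ) → Set (Fin n → Fin n → ℕ)) : PowerSeries ℚ :=
  PowerSeries.mk fun n => ((unlabel '' O n).ncard : ℚ)

/-- The formal power series `1 - exp (-x)`. -/
def oneSubExpNeg : PowerSeries ℚ :=
  1 - PowerSeries.rescale (-1 : ℚ) (PowerSeries.exp ℚ)

/-- Two incomparable elements are exchangeable if they are related in the same way to every
element. -/
def Exchangeable {n : ℕ} (w : Fin n → Fin n → ℕ) (i j : Fin n) : Prop :=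
  w i j = 0 ∧ w j i = 0 ∧ ∀ k, w i k = w j k ∧ w k i = w k j

/-- The structure with the element `i` removed. -/
def remove {n : ℕ} (w : Fin (n + 1) → Fin (n + 1) → ℕ) (i : Fin (n + 1)) :
    Fin n → Fin n → ℕ :=
  fun a b => w (i.succAbove a) (i.succAbove b)

/-- A garden: a family closed under relabeling, under cloning (adding an element exchangeable with
a given one) and under decloning (removing an element exchangeable with another one). -/
def IsGarden (O : (n : ℕ) → Set (Fin n → Fin n → ℕ)) : Prop :=
  RelabelingClosed O ∧
    ∀ (n : ℕ) (w : Fin (n + 1) → Fin (n + 1) → ℕ) (i j : Fin (n + 1)),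
      i ≠ j → Exchangeable w i j → (w ∈ O (n + 1) ↔ remove w i ∈ O n)

/-! Hyperplane arrangements -/

/-- The arrangement of all hyperplanes `x i - x j = l` with `i ≠ j` and `l` the distance of a marked
point of interval `j` from its left endpoint. -/
def markArrangement {n : ℕ} (S : Fin n → Shape) : Set (Set (Fin n → ℝ)) :=
  {H | ∃ i j : Fin n, i ≠ j ∧ ∃ l ∈ (S j).offsets, H = {x | x i - x j = l}}

/-- The braid arrangement: all hyperplanes `x i = x j` with `i ≠ j`. -/
def braidArrangement (n : ℕ) : Set (Set (Fin n → ℝ)) :=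
  {H | ∃ i j : Fin n, i ≠ j ∧ H = {x | x i = x j}}

/-- The regions of an arrangement: the connected components of the complement of the union of its
hyperplanes. -/
def regions {n : ℕ} (A : Set (Set (Fin n → ℝ))) : Set (Set (Fin n → ℝ)) :=
  {R | ∃ x ∈ (⋃₀ A)ᶜ, R = connectedComponentIn (⋃₀ A)ᶜ x}

end

end MarkedIntervalOrder

open MarkedIntervalOrder

namespace MarkedIntervalOrder

/-! Regions. The regions of an arrangement of hyperplanes `x i - x j = l` are the classes of generic
points on the same side of every hyperplane, because such classes are convex
(`mem_connectedComponentIn_generic_iff`). At a generic point the table of counts records exactly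
these sides (`orderAt_eq_iff`). Every table occurs at a generic point: since all `l` are positive, a
slight contraction towards the origin leaves the hyperplanes without changing the counts.

Unlabeled members. Closure under relabeling forces all the sets of offsets to coincide
(`offsets_eq_of_relabel_mem`). Permuting coordinates is then relabeling, and an isomorphism class
has only one table with weakly increasing left endpoints (`orderAt_eq_of_relabel_eq`). The `n!`
rearrangements of one strictly increasing generic representative give the regions over that class.

Generating functions. If `σ` fixes a marked interval order, columns `b` and `σ b` have equal sums
and are comparable, hence equal; so the rows agree as well, and the elements of a cycle are mutual
clones. In a garden the orders fixed by `σ` thus correspond to members on the cycles of `σ`, and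
Burnside's lemma gives `o n * n! = ∑ σ, a (cycleCount σ)`, where `a` and `o` count labeled and
unlabeled members. This relation is linear in `a`. For `a k = y ^ k` the two generating functions
are `exp (y x)` and `(1 - x)⁻ʸ`, linked by `x ↦ 1 - exp (-x)`; a polynomial identity in `y` extends
this to every `a`. -/

/-! ### Burnside's lemma and words constant on cycles -/

theorem card_range_mul_card_eq_sum_card_fixedBy {G X Y : Type*} [Group G] [Fintype G]
    [MulAction G X] [Finite X] (f : X → Y) (hf : ∀ x y, f x = f y ↔ ∃ g : G, g • x = y) :
    (Set.range f).ncard * Fintype.card G = ∑ g : G, Nat.card (MulAction.fixedBy X g) := by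
  classical
  have := Fintype.ofFinite X
  have := Fintype.ofFinite (Quotient (MulAction.orbitRel G X))
  simp only [Nat.card_eq_fintype_card]
  rw [MulAction.sum_card_fixedBy_eq_card_orbits_mul_card_group]
  congr 1
  rw [← Nat.card_coe_set_eq, ← Nat.card_eq_fintype_card]
  have hf' : ∀ x y, f x = f y ↔ (MulAction.orbitRel G X) x y := by
    intro x y
    rw [hf, MulAction.orbitRel_apply, MulAction.mem_orbit_iff]
    constructor
    · rintro ⟨g, rfl⟩; exact ⟨g⁻¹, by simp⟩
    · rintro ⟨g, rfl⟩; exact ⟨g⁻¹, by simp⟩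
  symm
  refine Nat.card_congr (Equiv.ofBijective
    (Quotient.lift (fun x => (⟨f x, x, rfl⟩ : Set.range f)) fun x y h => ?_) ⟨?_, ?_⟩)
  · exact Subtype.ext ((hf' x y).2 h)
  · rintro ⟨x⟩ ⟨y⟩ h
    exact Quotient.sound ((hf' x y).1 (congrArg Subtype.val h))
  · rintro ⟨_, x, rfl⟩
    exact ⟨Quotient.mk _ x, rfl⟩

/-- The number of cycles of a permutation, fixed points included. -/
noncomputable def cycleCount {n : ℕ} (σ : Equiv.Perm (Fin n)) : ℕ :=
  Nat.card (Quotient (Equiv.Perm.SameCycle.setoid σ))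

theorem eq_of_sameCycle {n : ℕ} {β : Type*} {σ : Equiv.Perm (Fin n)} {f : Fin n → β}
    (hf : ∀ a, f (σ a) = f a) {a b : Fin n} (h : σ.SameCycle a b) : f a = f b := by
  obtain ⟨i, hi⟩ := h.exists_pow_eq'
  rw [← hi.2]
  generalize i = i
  induction i with
  | zero => rfl
  | succ i ih => rw [pow_succ', Equiv.Perm.mul_apply, hf, ← ih]

theorem multiset_map_univ_eq_iff {n : ℕ} {α : Type*} [LinearOrder α] (f g : Fin n → α) :
    Multiset.ofList (List.ofFn f) = Multiset.ofList (List.ofFn g) ↔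
      ∃ σ : Equiv.Perm (Fin n), f ∘ σ = g := by
  constructor
  · intro h
    have h2 : List.ofFn (f ∘ Tuple.sort f) = List.ofFn (g ∘ Tuple.sort g) := by
      refine List.Perm.eq_of_pairwise' (r := (· ≤ ·)) ?_ ?_ ?_
      · exact (Tuple.monotone_sort f).sortedLE_ofFn.pairwise
      · exact (Tuple.monotone_sort g).sortedLE_ofFn.pairwise
      · exact ((Equiv.Perm.ofFn_comp_perm _ _).trans (Multiset.coe_eq_coe.1 h)).trans
          (Equiv.Perm.ofFn_comp_perm _ _).symm
    have h3 := List.ofFn_injective h2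
    refine ⟨Tuple.sort f * (Tuple.sort g)⁻¹, ?_⟩
    funext a
    have := congrFun h3 ((Tuple.sort g)⁻¹ a)
    simpa using this
  · rintro ⟨σ, rfl⟩
    exact Multiset.coe_eq_coe.2 (Equiv.Perm.ofFn_comp_perm σ f).symm

/-- Burnside's lemma for permutations of positions in words of length `n` over `y` letters: orbits
are multisets of size `n`, and a word is fixed by `σ` when it is constant on the cycles of `σ`. -/
theorem sum_pow_cycleCount (n y : ℕ) :
    ∑ σ : Equiv.Perm (Fin n), y ^ cycleCount σ = y.multichoose n * n.factorial := by
  classical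
  let act : MulAction (Equiv.Perm (Fin n)) (Fin n → Fin y) :=
    { smul := fun σ f => f ∘ ⇑σ⁻¹
      one_smul := fun f => rfl
      mul_smul := fun σ τ f => by
        change f ∘ ⇑(σ * τ)⁻¹ = (f ∘ ⇑τ⁻¹) ∘ ⇑σ⁻¹
        funext a; simp }
  have hsmul : ∀ (σ : Equiv.Perm (Fin n)) (f : Fin n → Fin y), σ • f = f ∘ ⇑σ⁻¹ := fun _ _ => rfl
  let F : (Fin n → Fin y) → Sym (Fin y) n := fun f => ⟨Multiset.ofList (List.ofFn f), by simp⟩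
  have key := card_range_mul_card_eq_sum_card_fixedBy (G := Equiv.Perm (Fin n)) F (by
    intro f g
    refine Subtype.ext_iff.trans ((multiset_map_univ_eq_iff f g).trans ?_)
    constructor
    · rintro ⟨σ, rfl⟩; exact ⟨σ⁻¹, by simp [hsmul]⟩
    · rintro ⟨σ, rfl⟩; exact ⟨σ⁻¹, by simp [hsmul]⟩)
  have hsurj : Function.Surjective F := by
    rintro ⟨m, hm⟩
    induction m using Quotient.inductionOn with
    | h l =>
      have hl : l.length = n := by simpa using hm
      subst hl
      exact ⟨l.get, Subtype.ext (by simp [F])⟩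
  rw [hsurj.range_eq, Set.ncard_univ, Sym.natCard_sym_eq_multichoose, Nat.card_fin,
    Fintype.card_perm, Fintype.card_fin] at key
  rw [key]
  refine Finset.sum_congr rfl fun σ _ => ?_
  have : Nat.card (Quotient (Equiv.Perm.SameCycle.setoid σ) → Fin y) = y ^ cycleCount σ := by
    rw [Nat.card_fun, Nat.card_fin]; rfl
  rw [← this]
  refine Nat.card_congr (Equiv.ofBijective
    (fun f => ⟨fun a => f (Quotient.mk _ a), ?_⟩) ⟨?_, ?_⟩)
  · rw [MulAction.mem_fixedBy, hsmul]
    funext a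
    refine congrArg f (Quotient.sound ?_)
    change σ.SameCycle _ _
    simp [Equiv.Perm.SameCycle.refl]
  · intro f g h
    funext q
    induction q using Quotient.inductionOn with
    | h a => exact congrFun (congrArg Subtype.val h) a
  · rintro ⟨f, hf⟩
    rw [MulAction.mem_fixedBy, hsmul] at hf
    refine ⟨Quotient.lift f fun a b h => eq_of_sameCycle (fun a => ?_) h, rfl⟩
    simpa using (congrFun hf (σ a)).symm

/-! ### Substitution of 1 - exp(-x) in power series -/

open PowerSeries in
theorem constantCoeff_oneSubExpNeg : constantCoeff oneSubExpNeg = 0 := by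
  rw [oneSubExpNeg, map_sub, map_one, ← coeff_zero_eq_constantCoeff_apply (rescale _ _),
    coeff_rescale]
  simp

theorem hasSubst_oneSubExpNeg : PowerSeries.HasSubst oneSubExpNeg :=
  PowerSeries.HasSubst.of_constantCoeff_zero' constantCoeff_oneSubExpNeg

open PowerSeries in
theorem coeff_oneSubExpNeg_pow_eq_zero {n k : ℕ} (h : n < k) : coeff n (oneSubExpNeg ^ k) = 0 := by
  have hX : (X : PowerSeries ℚ) ^ k ∣ oneSubExpNeg ^ k := pow_dvd_pow_of_dvd (X_dvd_iff.2 constantCoeff_oneSubExpNeg) k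
  exact X_pow_dvd_iff.1 hX n h

open PowerSeries in
theorem coeff_subst_oneSubExpNeg (f : PowerSeries ℚ) (n : ℕ) :
    coeff n (f.subst oneSubExpNeg) =
      ∑ k ∈ Finset.range (n + 1), coeff k f * coeff n (oneSubExpNeg ^ k) := by
  rw [coeff_subst' hasSubst_oneSubExpNeg]
  refine finsum_eq_sum_of_support_subset _ fun k hk => ?_
  by_contra hkn
  simp only [Finset.coe_range, Set.mem_Iio, not_lt] at hkn
  exact hk (by simp [coeff_oneSubExpNeg_pow_eq_zero (show n < k by omega)])

open PowerSeries in
theorem subst_mk_one_eq_exp : (mk 1 : PowerSeries ℚ).subst oneSubExpNeg = exp ℚ := by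
  have h1 := congrArg (subst oneSubExpNeg) (mk_one_mul_one_sub_eq_one ℚ)
  have hone : (1 : PowerSeries ℚ).subst oneSubExpNeg = 1 := by
    rw [← coe_substAlgHom hasSubst_oneSubExpNeg, map_one]
  rw [subst_mul hasSubst_oneSubExpNeg, ← coe_substAlgHom hasSubst_oneSubExpNeg, map_sub, map_one,
    coe_substAlgHom, subst_X hasSubst_oneSubExpNeg] at h1
  have h2 : (1 : PowerSeries ℚ) - oneSubExpNeg = evalNegHom (exp ℚ) := by
    simp [oneSubExpNeg, evalNegHom]
  rw [h2] at h1
  calc _ = subst oneSubExpNeg (mk 1 : PowerSeries ℚ) * (exp ℚ * evalNegHom (exp ℚ)) := by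
        rw [exp_mul_exp_neg_eq_one, mul_one]
    _ = exp ℚ * (subst oneSubExpNeg (mk 1 : PowerSeries ℚ) * evalNegHom (exp ℚ)) := by ring
    _ = _ := by rw [h1, mul_one]

-- Coefficient of `xⁿ` after substituting `1 - exp (-x)` into `(1 - x)⁻⁽ᵈ⁺¹⁾`, which yields `exp ((d
-- + 1) x)`.
open PowerSeries in
theorem sum_multichoose_mul_coeff (n d : ℕ) :
    ∑ k ∈ Finset.range (n + 1), ((d + 1).multichoose k : ℚ) * coeff n (oneSubExpNeg ^ k) =
      ((d + 1 : ℕ) : ℚ) ^ n / n.factorial := by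
  have h := congrArg (subst oneSubExpNeg) (mk_one_pow_eq_mk_choose_add ℚ d)
  rw [subst_pow hasSubst_oneSubExpNeg, subst_mk_one_eq_exp, exp_pow_eq_rescale_exp] at h
  have h2 := congrArg (coeff n) h
  rw [coeff_subst_oneSubExpNeg, coeff_rescale, coeff_exp] at h2
  simp only [coeff_mk] at h2
  calc _ = _ := Finset.sum_congr rfl fun k _ => by
        rw [Nat.multichoose_eq, show d + 1 + k - 1 = d + k by omega, Nat.choose_symm_add]
    _ = _ := h2.symm
    _ = _ := by simp [div_eq_mul_inv]

/-- Two sequences linked by the cycle structure of permutations have generating functions linked by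
the substitution of `1 - exp (-x)`. -/
theorem mk_div_factorial_eq_subst (a o : ℕ → ℕ)
    (h : ∀ n, o n * n.factorial = ∑ σ : Equiv.Perm (Fin n), a (cycleCount σ)) :
    (PowerSeries.mk fun n => (a n : ℚ) / n.factorial) =
      (PowerSeries.mk fun n => (o n : ℚ)).subst oneSubExpNeg := by
  -- `q k` is the value of `o k` for the model sequence `a j = X ^ j`; the functional `T : X ^ j ↦ a
  -- j` carries the model to the given sequences.
  let q : ℕ → Polynomial ℚ := fun k =>
    Polynomial.C ((k.factorial : ℚ)⁻¹) *
      ∑ σ : Equiv.Perm (Fin k), (Polynomial.X : Polynomial ℚ) ^ cycleCount σ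
  let T : Polynomial ℚ →ₗ[ℚ] ℚ := Polynomial.lsum fun k => (a k : ℚ) • LinearMap.id
  have hT : ∀ k, T (Polynomial.X ^ k) = a k := by
    intro k
    simp [T, Polynomial.X_pow_eq_monomial]
  have hTq : ∀ k, T (q k) = o k := by
    intro k
    have hk := h k
    have hf : (k.factorial : ℚ) ≠ 0 := by exact_mod_cast k.factorial_ne_zero
    simp only [q, ← Polynomial.smul_eq_C_mul, map_smul, map_sum, hT]
    rw [← Nat.cast_sum, ← hk, smul_eq_mul]
    push_cast
    field_simp
  ext n
  -- The desired identity for the model sequence. Both sides are polynomials, so agreement at the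
  -- positive integers `d + 1` suffices.
  have hpoly : Polynomial.C ((n.factorial : ℚ)⁻¹) * (Polynomial.X : Polynomial ℚ) ^ n =
      ∑ k ∈ Finset.range (n + 1), Polynomial.C (PowerSeries.coeff n (oneSubExpNeg ^ k)) * q k := by
    refine Polynomial.eq_of_infinite_eval_eq _ _ ((Set.infinite_range_of_injective
      (f := fun d : ℕ => ((d + 1 : ℕ) : ℚ)) fun x y hxy => ?_).mono ?_)
    · simpa using hxy
    · rintro _ ⟨d, rfl⟩
      have hq : ∀ k, (q k).eval ((d + 1 : ℕ) : ℚ) = (d + 1).multichoose k := by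
        intro k
        have hf : (k.factorial : ℚ) ≠ 0 := by exact_mod_cast k.factorial_ne_zero
        have hs := congrArg (Nat.cast : ℕ → ℚ) (sum_pow_cycleCount k (d + 1))
        rw [Nat.cast_sum] at hs
        simp only [Nat.cast_pow] at hs
        simp only [q, Polynomial.eval_mul, Polynomial.eval_C, Polynomial.eval_finsetSum,
          Polynomial.eval_pow, Polynomial.eval_X]
        rw [hs]
        push_cast
        field_simp
      have := sum_multichoose_mul_coeff n d
      simp only [Set.mem_ofPred_eq, Polynomial.eval_mul, Polynomial.eval_C,
        Polynomial.eval_finsetSum, Polynomial.eval_pow, Polynomial.eval_X, hq]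
      rw [inv_mul_eq_div, ← this]
      exact Finset.sum_congr rfl fun k _ => mul_comm _ _
  have := congrArg T hpoly
  simp only [← Polynomial.smul_eq_C_mul, map_smul, map_sum, hT, hTq, smul_eq_mul] at this
  rw [coeff_subst_oneSubExpNeg, PowerSeries.coeff_mk, div_eq_inv_mul, this]
  exact Finset.sum_congr rfl fun k _ => by rw [PowerSeries.coeff_mk, mul_comm]

/-! Gardens -/

theorem IsMarkedIntervalOrder.diag {n : ℕ} {w : Fin n → Fin n → ℕ} (hw : IsMarkedIntervalOrder w)
    (a : Fin n) : w a a = 0 := by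
  obtain ⟨I, rfl⟩ := hw
  simp only [orderOfIntervals, marksBefore, Finset.card_eq_zero, Finset.filter_eq_empty_iff, not_lt]
  exact fun m hm => ((I a).marks_mem m hm).1.le

/-- A column depends on its interval only through the left endpoint, and monotonically. Rows need
not be comparable, since marks may differ. Apart from the zero diagonal, this is all that gardens
need from the geometry. -/
theorem IsMarkedIntervalOrder.columns_total {n : ℕ} {w : Fin n → Fin n → ℕ}
    (hw : IsMarkedIntervalOrder w) (a b : Fin n) :
    (∀ k, w k a ≤ w k b) ∨ (∀ k, w k b ≤ w k a) := by
  obtain ⟨I, rfl⟩ := hw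
  refine (le_total (I a).left (I b).left).imp ?_ ?_ <;>
  · intro h k
    exact Finset.card_le_card (Finset.monotone_filter_right _ fun m _ hm => lt_of_lt_of_le hm h)

theorem forall_eq_of_sum_eq {n : ℕ} {f g : Fin n → ℕ} (h : (∀ k, f k ≤ g k) ∨ (∀ k, g k ≤ f k))
    (hs : ∑ k, f k = ∑ k, g k) (k : Fin n) : f k = g k := by
  rcases h with h | h
  · exact (Finset.sum_eq_sum_iff_of_le fun i _ => h i).1 hs k (Finset.mem_univ k)
  · exact ((Finset.sum_eq_sum_iff_of_le fun i _ => h i).1 hs.symm k (Finset.mem_univ k)).symm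

/-- Column `σ b` is a rearrangement of column `b`, so the two comparable columns have equal sums and
coincide. Invariance of rows follows from invariance of columns and of the whole table. -/
theorem IsMarkedIntervalOrder.apply_eq_of_relabel_eq {n : ℕ} {w : Fin n → Fin n → ℕ}
    (hw : IsMarkedIntervalOrder w) {σ : Equiv.Perm (Fin n)} (h : relabel σ w = w) (a b : Fin n) :
    w a (σ b) = w a b ∧ w (σ a) b = w a b := by
  have h' : ∀ a b, w (σ a) (σ b) = w a b := fun a b => congrFun (congrFun h a) b
  have hcol : ∀ a b, w a (σ b) = w a b := fun a b =>
    forall_eq_of_sum_eq (hw.columns_total _ _)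
      (by rw [← Equiv.sum_comp σ fun k => w k (σ b)]; simp [h']) a
  exact ⟨hcol a b, by rw [← hcol (σ a) b, h']⟩

/-- Two labels with the same image under `f` are clones, so one can be removed while `f` stays
surjective; once `f` is bijective, only a relabeling remains. -/
theorem IsGarden.pullback_mem_iff {O : (n : ℕ) → Set (Fin n → Fin n → ℕ)} (hO : IsGarden O)
    {m : ℕ} (v : Fin m → Fin m → ℕ) (hv : ∀ a, v a a = 0) {n : ℕ} (f : Fin n → Fin m)
    (hf : Function.Surjective f) : (fun a b => v (f a) (f b)) ∈ O n ↔ v ∈ O m := by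
  induction n with
  | zero =>
    have hm : m = 0 := by
      have := Fintype.card_le_of_surjective f hf
      simpa using this
    subst hm
    rw [show (fun a b => v (f a) (f b)) = v from funext fun a => a.elim0]
  | succ n ih =>
    by_cases hinj : Function.Injective f
    · have hm : n + 1 = m := by simpa using Fintype.card_of_bijective ⟨hinj, hf⟩
      subst hm
      let σ := Equiv.ofBijective f ⟨hinj, hf⟩
      refine ⟨fun h => ?_, fun h => hO.1 _ v h σ⟩
      have := hO.1 _ _ h σ⁻¹
      convert this using 1
      funext a b
      change v a b = v (σ (σ⁻¹ a)) (σ (σ⁻¹ b))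
      simp
    · obtain ⟨i, j, hij, hne⟩ : ∃ i j, f i = f j ∧ i ≠ j := by
        simpa [Function.Injective] using hinj
      rw [hO.2 n _ i j hne ⟨by simp [hij, hv], by simp [hij, hv], fun k => by simp [hij]⟩]
      refine ih (f ∘ i.succAbove) fun b => ?_
      obtain ⟨a, rfl⟩ := hf b
      by_cases ha : a = i
      · obtain ⟨z, hz⟩ := Fin.exists_succAbove_eq hne.symm
        exact ⟨z, by simp [hz, ha, hij]⟩
      · obtain ⟨z, hz⟩ := Fin.exists_succAbove_eq ha
        exact ⟨z, by simp [hz]⟩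

/-- A table fixed by `σ` is constant on cycles in each argument, so it is the pullback of a unique
table on the set of cycles. -/
theorem IsGarden.card_fixed {O : (n : ℕ) → Set (Fin n → Fin n → ℕ)} (hO : IsGarden O)
    (hreal : ∀ n, ∀ w ∈ O n, IsMarkedIntervalOrder w) {n : ℕ} (σ : Equiv.Perm (Fin n)) :
    Nat.card {w : O n // relabel σ w.1 = w.1} = (O (cycleCount σ)).ncard := by
  let e : Quotient (Equiv.Perm.SameCycle.setoid σ) ≃ Fin (cycleCount σ) := Finite.equivFin _
  let f : Fin n → Fin (cycleCount σ) := fun a => e (Quotient.mk _ a)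
  have hf : Function.Surjective f := e.surjective.comp Quotient.mk_surjective
  have hfσ : ∀ a, f (σ a) = f a := fun a => congrArg e (Quotient.sound (by
    change σ.SameCycle _ _
    simp [Equiv.Perm.SameCycle.refl]))
  rw [← Nat.card_coe_set_eq]
  symm
  refine Nat.card_congr (Equiv.ofBijective (fun v => ⟨⟨fun a b => v.1 (f a) (f b),
    (hO.pullback_mem_iff v.1 (hreal _ _ v.2).diag f hf).2 v.2⟩, ?_⟩) ⟨?_, ?_⟩)
  · funext a b
    simp [relabel, hfσ]
  · intro v v' h
    ext x y
    obtain ⟨a, rfl⟩ := hf x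
    obtain ⟨b, rfl⟩ := hf y
    exact congrFun (congrFun (congrArg (fun w => w.1.1) h) a) b
  · rintro ⟨⟨w, hw⟩, hσ⟩
    have hinv := (hreal _ _ hw).apply_eq_of_relabel_eq hσ
    have hwf : ∀ a a' b b', f a = f a' → f b = f b' → w a b = w a' b' := by
      intro a a' b b' ha hb
      have ha' : σ.SameCycle a a' := Quotient.exact (e.injective ha)
      have hb' : σ.SameCycle b b' := Quotient.exact (e.injective hb)
      rw [eq_of_sameCycle (f := fun a => w a b) (fun a => (hinv a b).2) ha',
        eq_of_sameCycle (f := fun b => w a' b) (fun b => (hinv a' b).1) hb']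
    let g := Function.surjInv hf
    have hg : ∀ x, f (g x) = x := Function.surjInv_eq hf
    have hv : (fun a b => w (g (f a)) (g (f b))) = w :=
      funext fun a => funext fun b => hwf _ _ _ _ (hg _) (hg _)
    refine ⟨⟨fun x y => w (g x) (g y), ?_⟩, Subtype.ext (Subtype.ext hv)⟩
    refine (hO.pullback_mem_iff (fun x y => w (g x) (g y)) (fun x => (hreal _ _ hw).diag _) f hf).1 ?_
    rw [hv]
    exact hw

theorem IsGarden.card_unlabel_mul_factorial {O : (n : ℕ) → Set (Fin n → Fin n → ℕ)}
    (hO : IsGarden O) (hfin : ∀ n, (O n).Finite)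
    (hreal : ∀ n, ∀ w ∈ O n, IsMarkedIntervalOrder w) (n : ℕ) :
    (unlabel '' O n).ncard * n.factorial =
      ∑ σ : Equiv.Perm (Fin n), (O (cycleCount σ)).ncard := by
  have := (hfin n).to_subtype
  let act : MulAction (Equiv.Perm (Fin n)) (O n) :=
    { smul := fun σ w => ⟨relabel σ⁻¹ w.1, hO.1 n _ w.2 _⟩
      one_smul := fun w => rfl
      mul_smul := fun σ τ w => Subtype.ext (by
        change relabel (σ * τ)⁻¹ w.1 = relabel σ⁻¹ (relabel τ⁻¹ w.1)
        funext a b; simp [relabel]) }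
  have hsmul : ∀ (σ : Equiv.Perm (Fin n)) (w : O n), (σ • w).1 = relabel σ⁻¹ w.1 := fun _ _ => rfl
  have key := card_range_mul_card_eq_sum_card_fixedBy (G := Equiv.Perm (Fin n))
    (fun w : O n => unlabel w.1) (by
      intro w w'
      refine Quotient.eq.trans ?_
      constructor
      · rintro ⟨σ, hσ⟩; exact ⟨σ⁻¹, Subtype.ext (by rw [hsmul, inv_inv, hσ])⟩
      · rintro ⟨σ, rfl⟩; exact ⟨σ⁻¹, hsmul _ _⟩)
  have hrange : Set.range (fun w : O n => unlabel w.1) = unlabel '' O n := by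
    rw [Set.image_eq_range]
  rw [hrange, Fintype.card_perm, Fintype.card_fin] at key
  -- The left action is by `relabel σ⁻¹`; summing over inverses removes the inversion.
  rw [key, ← Equiv.sum_comp (Equiv.inv _)]
  refine Finset.sum_congr rfl fun σ _ => ?_
  rw [← hO.card_fixed hreal]
  refine Nat.card_congr (Equiv.subtypeEquivRight fun w => ?_)
  rw [MulAction.mem_fixedBy, Subtype.ext_iff, hsmul]
  simp

theorem IsGarden.egf_eq {O : (n : ℕ) → Set (Fin n → Fin n → ℕ)}
    (hO : IsGarden O) (hfin : ∀ n, (O n).Finite)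
    (hreal : ∀ n, ∀ w ∈ O n, IsMarkedIntervalOrder w) :
    egf O = (ogf O).subst oneSubExpNeg :=
  mk_div_factorial_eq_subst _ _ (hO.card_unlabel_mul_factorial hfin hreal)

/-! Regions of arrangements of hyperplanes `x i - x j = l` -/

/-- The points on none of the hyperplanes `x i - x j = l` with `l ∈ M j`. -/
def generic {n : ℕ} (M : Fin n → Finset ℝ) : Set (Fin n → ℝ) :=
  {x | ∀ i j, i ≠ j → ∀ l ∈ M j, x i - x j ≠ l}

/-- Two points lie on the same side of every hyperplane `x i - x j = l` with `l ∈ M j`. -/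
def SameSide {n : ℕ} (M : Fin n → Finset ℝ) (x y : Fin n → ℝ) : Prop :=
  ∀ i j, i ≠ j → ∀ l ∈ M j, (x i - x j < l ↔ y i - y j < l)

theorem SameSide.symm {n : ℕ} {M : Fin n → Finset ℝ} {x y : Fin n → ℝ} (h : SameSide M x y) :
    SameSide M y x := fun i j hij l hl => (h i j hij l hl).symm

theorem SameSide.comp_perm {n : ℕ} {L : Finset ℝ} {x y : Fin n → ℝ}
    (h : SameSide (fun _ => L) x y) (σ : Equiv.Perm (Fin n)) :
    SameSide (fun _ => L) (x ∘ σ) (y ∘ σ) :=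
  fun _ _ hij l hl => h _ _ (σ.injective.ne hij) l hl

theorem generic_comp_perm {n : ℕ} {L : Finset ℝ} {x : Fin n → ℝ}
    (h : x ∈ generic (fun _ => L)) (σ : Equiv.Perm (Fin n)) : x ∘ σ ∈ generic (fun _ => L) :=
  fun _ _ hij l hl => h _ _ (σ.injective.ne hij) l hl

theorem compl_markArrangement {n : ℕ} (S : Fin n → Shape) :
    (⋃₀ markArrangement S)ᶜ = generic (fun j => (S j).offsets) := by
  ext x
  simp only [Set.mem_compl_iff, Set.mem_sUnion, not_exists, not_and]
  constructor
  · intro h i j hij l hl he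
    exact h _ ⟨i, j, hij, l, hl, rfl⟩ he
  · rintro h _ ⟨i, j, hij, l, hl, rfl⟩ he
    exact h i j hij l hl he

theorem compl_markArrangement_union_braidArrangement {n : ℕ} (S : Fin n → Shape) :
    (⋃₀ (markArrangement S ∪ braidArrangement n))ᶜ =
      generic (fun j => insert 0 (S j).offsets) := by
  ext x
  rw [Set.sUnion_union, Set.compl_union, compl_markArrangement]
  simp only [Set.mem_inter_iff, Set.mem_compl_iff, Set.mem_sUnion, not_exists, not_and]
  constructor
  · rintro ⟨h, h0⟩ i j hij l hl he
    rcases Finset.mem_insert.1 hl with rfl | hl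
    · exact h0 _ ⟨i, j, hij, rfl⟩ (sub_eq_zero.1 he)
    · exact h i j hij l hl he
  · intro h
    refine ⟨fun i j hij l hl => h i j hij l (Finset.mem_insert_of_mem hl), ?_⟩
    rintro _ ⟨i, j, hij, rfl⟩ he
    exact h i j hij 0 (Finset.mem_insert_self _ _) (sub_eq_zero.2 he)

/-- On a component, `z i - z j` takes an interval of values omitting `l`, so it cannot cross `l`.
Conversely the points on the same side as `x` form a convex, hence connected, set. -/
theorem mem_connectedComponentIn_generic_iff {n : ℕ} {M : Fin n → Finset ℝ} {x y : Fin n → ℝ}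
    (hx : x ∈ generic M) :
    y ∈ connectedComponentIn (generic M) x ↔ y ∈ generic M ∧ SameSide M x y := by
  constructor
  · intro hy
    have hyg := connectedComponentIn_subset _ _ hy
    refine ⟨hyg, fun i j hij l hl => ?_⟩
    have hcont : ContinuousOn (fun z : Fin n → ℝ => z i - z j) (connectedComponentIn (generic M) x) :=
      Continuous.continuousOn (by fun_prop)
    have hoc := (isPreconnected_connectedComponentIn.image _ hcont).ordConnected
    have hmx := Set.mem_image_of_mem (fun z : Fin n → ℝ => z i - z j) (mem_connectedComponentIn hx)
    have hmy := Set.mem_image_of_mem (fun z : Fin n → ℝ => z i - z j) hy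
    have hne : l ∉ (fun z : Fin n → ℝ => z i - z j) '' connectedComponentIn (generic M) x := by
      rintro ⟨z, hz, hzl⟩
      exact connectedComponentIn_subset _ _ hz i j hij l hl hzl
    constructor
    · intro h
      by_contra h'
      exact hne (hoc.out hmx hmy ⟨h.le, not_lt.1 h'⟩)
    · intro h
      by_contra h'
      exact hne (hoc.out hmy hmx ⟨h.le, not_lt.1 h'⟩)
  · rintro ⟨hy, hxy⟩
    have hconv : Convex ℝ {z | z ∈ generic M ∧ SameSide M x z} := by
      rw [convex_iff_forall_pos]
      rintro z ⟨hz, hxz⟩ z' ⟨hz', hxz'⟩ s t hs ht hst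
      have key : ∀ i j, i ≠ j → ∀ l ∈ M j,
          (x i - x j < l → (s • z + t • z') i - (s • z + t • z') j < l) ∧
          (l < x i - x j → l < (s • z + t • z') i - (s • z + t • z') j) := by
        intro i j hij l hl
        have e : (s • z + t • z') i - (s • z + t • z') j = s * (z i - z j) + t * (z' i - z' j) := by
          simp only [Pi.add_apply, Pi.smul_apply, smul_eq_mul]; ring
        have el : l = s * l + t * l := by rw [← add_mul, hst, one_mul]
        rw [e]
        constructor
        · intro h
          have h1 := mul_lt_mul_of_pos_left ((hxz i j hij l hl).1 h) hs
          have h2 := mul_lt_mul_of_pos_left ((hxz' i j hij l hl).1 h) ht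
          linarith
        · intro h
          have h1 := mul_lt_mul_of_pos_left (lt_of_le_of_ne
            (not_lt.1 (mt (hxz i j hij l hl).2 h.le.not_gt)) (hz i j hij l hl).symm) hs
          have h2 := mul_lt_mul_of_pos_left (lt_of_le_of_ne
            (not_lt.1 (mt (hxz' i j hij l hl).2 h.le.not_gt)) (hz' i j hij l hl).symm) ht
          linarith
      refine ⟨fun i j hij l hl => ?_, fun i j hij l hl => ⟨(key i j hij l hl).1, fun h => ?_⟩⟩
      · rcases lt_or_gt_of_ne (hx i j hij l hl) with h | h
        · exact ((key i j hij l hl).1 h).ne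
        · exact ((key i j hij l hl).2 h).ne'
      · by_contra h'
        exact ((key i j hij l hl).2
          (lt_of_le_of_ne (not_lt.1 h') (hx i j hij l hl).symm)).not_gt h
    exact hconv.isPreconnected.subset_connectedComponentIn
      ⟨hx, fun _ _ _ _ _ => Iff.rfl⟩ (fun z hz => hz.1) ⟨hy, hxy⟩

theorem connectedComponentIn_generic_eq_iff {n : ℕ} {M : Fin n → Finset ℝ} {x y : Fin n → ℝ}
    (hx : x ∈ generic M) (hy : y ∈ generic M) :
    connectedComponentIn (generic M) x = connectedComponentIn (generic M) y ↔ SameSide M x y := by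
  constructor
  · intro h
    exact ((mem_connectedComponentIn_generic_iff hx).1 (h ▸ mem_connectedComponentIn hy)).2
  · intro h
    exact connectedComponentIn_eq ((mem_connectedComponentIn_generic_iff hx).2 ⟨hy, h⟩)

open Filter Topology in
theorem eventually_mem_generic {n : ℕ} {M : Fin n → Finset ℝ} {x : Fin n → ℝ}
    (hx : x ∈ generic M) : ∀ᶠ y in 𝓝 x, y ∈ generic M ∧ SameSide M x y := by
  have h : ∀ᶠ y in 𝓝 x, ∀ i j, i ≠ j → ∀ l ∈ M j,
      y i - y j ≠ l ∧ (x i - x j < l ↔ y i - y j < l) := by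
    refine eventually_all.2 fun i => eventually_all.2 fun j => eventually_all.2 fun hij =>
      (eventually_all_finset _).2 fun l hl => ?_
    have hc : Tendsto (fun y : Fin n → ℝ => y i - y j) (𝓝 x) (𝓝 (x i - x j)) :=
      Continuous.tendsto (by fun_prop) x
    rcases lt_or_gt_of_ne (hx i j hij l hl) with h | h
    · filter_upwards [hc.eventually_lt_const h] with y hy
      exact ⟨hy.ne, by simp [h, hy]⟩
    · filter_upwards [hc.eventually_const_lt h] with y hy
      exact ⟨hy.ne', iff_of_false h.not_gt hy.not_gt⟩
  filter_upwards [h] with y hy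
  exact ⟨fun i j hij l hl => (hy i j hij l hl).1, fun i j hij l hl => (hy i j hij l hl).2⟩

/-! The table of a placement -/

theorem orderAt_apply {n : ℕ} (S : Fin n → Shape) (x : Fin n → ℝ) (a b : Fin n) :
    orderAt S x a b = ((S a).offsets.filter (· < x b - x a)).card := by
  change (((S a).offsets.image (fun l => x a + l)).filter (fun m => m < x b)).card = _
  rw [Finset.filter_image, Finset.card_image_of_injective _ (add_right_injective (x a))]
  congr 1
  ext l
  simp [lt_sub_iff_add_lt']

theorem isMarkedIntervalOrder_of_mem {n : ℕ} {S : Fin n → Shape} {w : Fin n → Fin n → ℕ}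
    (hw : w ∈ labeledMembers S) : IsMarkedIntervalOrder w := by
  obtain ⟨x, rfl⟩ := hw
  exact ⟨_, rfl⟩

theorem finite_labeledMembers {n : ℕ} (S : Fin n → Shape) : (labeledMembers S).Finite := by
  refine (Set.finite_Icc 0 fun a _ => (S a).offsets.card).subset ?_
  rintro _ ⟨x, rfl⟩
  refine ⟨fun a b => Nat.zero_le _, fun a b => ?_⟩
  rw [orderAt_apply]
  exact Finset.card_filter_le _ _

/-- The two sets are nested. Hence the number of marks to the left of a point determines which marks
they are. -/
theorem filter_lt_eq_of_card_eq {L : Finset ℝ} {s t : ℝ}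
    (h : (L.filter (· < s)).card = (L.filter (· < t)).card) :
    L.filter (· < s) = L.filter (· < t) := by
  rcases le_total s t with hst | hst
  · exact Finset.eq_of_subset_of_card_le
      (Finset.monotone_filter_right _ fun l _ hl => lt_of_lt_of_le hl hst) h.ge
  · exact (Finset.eq_of_subset_of_card_le
      (Finset.monotone_filter_right _ fun l _ hl => lt_of_lt_of_le hl hst) h.le).symm

theorem orderAt_self {n : ℕ} (S : Fin n → Shape) (x : Fin n → ℝ) (a : Fin n) :
    orderAt S x a a = 0 := (isMarkedIntervalOrder_of_mem ⟨x, rfl⟩).diag a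

theorem orderAt_eq_iff {n : ℕ} (S : Fin n → Shape) {x y : Fin n → ℝ}
    (hx : x ∈ generic (fun j => (S j).offsets)) (hy : y ∈ generic (fun j => (S j).offsets)) :
    orderAt S x = orderAt S y ↔ SameSide (fun j => (S j).offsets) x y := by
  have hlt : ∀ {x : Fin n → ℝ}, x ∈ generic (fun j => (S j).offsets) →
      ∀ i j, i ≠ j → ∀ l ∈ (S j).offsets, (l < x i - x j ↔ ¬ x i - x j < l) :=
    fun hx i j hij l hl =>
      ⟨fun h => h.not_gt, fun h => lt_of_le_of_ne (not_lt.1 h) (hx i j hij l hl).symm⟩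
  constructor
  · intro h i j hij l hl
    have h1 := congrFun (congrFun h j) i
    rw [orderAt_apply, orderAt_apply] at h1
    have h2 := Finset.ext_iff.1 (filter_lt_eq_of_card_eq h1) l
    simp only [Finset.mem_filter, hl, true_and] at h2
    rw [hlt hx i j hij l hl, hlt hy i j hij l hl] at h2
    exact not_iff_not.1 h2
  · intro h
    funext a b
    by_cases hab : b = a
    · subst hab
      rw [orderAt_self, orderAt_self]
    · rw [orderAt_apply, orderAt_apply]
      congr 1
      refine Finset.filter_congr fun l hl => ?_
      rw [hlt hx b a hab l hl, hlt hy b a hab l hl, h b a hab l hl]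

open Filter Topology in
/-- Shrinking a placement slightly makes it generic without changing its table. -/
theorem eventually_smul_mem_generic {n : ℕ} (S : Fin n → Shape) (x : Fin n → ℝ) :
    ∀ᶠ ε in 𝓝[>] (0 : ℝ), (1 - ε) • x ∈ generic (fun j => (S j).offsets) ∧
      orderAt S ((1 - ε) • x) = orderAt S x := by
  have h : ∀ᶠ ε in 𝓝[>] (0 : ℝ), ∀ i j : Fin n, ∀ l ∈ (S j).offsets,
      (1 - ε) * (x i - x j) ≠ l ∧ (l < (1 - ε) * (x i - x j) ↔ l < x i - x j) := by
    refine eventually_all.2 fun i => eventually_all.2 fun j =>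
      (eventually_all_finset _).2 fun l hl => ?_
    have hc : Tendsto (fun ε : ℝ => (1 - ε) * (x i - x j)) (𝓝[>] 0) (𝓝 (x i - x j)) := by
      have : Tendsto (fun ε : ℝ => (1 - ε) * (x i - x j)) (𝓝 0) (𝓝 ((1 - 0) * (x i - x j))) :=
        Continuous.tendsto (by fun_prop) 0
      rw [sub_zero, one_mul] at this
      exact this.mono_left nhdsWithin_le_nhds
    rcases lt_trichotomy (x i - x j) l with h | h | h
    · filter_upwards [hc.eventually_lt_const h] with ε hε
      exact ⟨hε.ne, iff_of_false hε.not_gt h.not_gt⟩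
    -- A mark coinciding with a left endpoint is not counted; as `l > 0`, contraction puts the
    -- endpoint strictly before the mark, which stays uncounted.
    · filter_upwards [self_mem_nhdsWithin] with ε hε
      have hε' : 0 < ε := hε
      have hl0 := ((S j).offsets_mem l hl).1
      rw [h]
      have : (1 - ε) * l < l := by nlinarith
      exact ⟨this.ne, iff_of_false this.not_gt (lt_irrefl l)⟩
    · filter_upwards [hc.eventually_const_lt h] with ε hε
      exact ⟨hε.ne', by simp [h, hε]⟩
  filter_upwards [h] with ε hε
  have e : ∀ i j, ((1 - ε) • x) i - ((1 - ε) • x) j = (1 - ε) * (x i - x j) := fun i j => by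
    simp only [Pi.smul_apply, smul_eq_mul]; ring
  refine ⟨fun i j _ l hl => by rw [e]; exact (hε i j l hl).1, ?_⟩
  funext a b
  rw [orderAt_apply, orderAt_apply, e]
  congr 1
  exact Finset.filter_congr fun l hl => (hε b a l hl).2

theorem exists_mem_generic_orderAt_eq {n : ℕ} (S : Fin n → Shape) (x : Fin n → ℝ) :
    ∃ y ∈ generic (fun j => (S j).offsets), orderAt S y = orderAt S x := by
  obtain ⟨ε, hε⟩ := (eventually_smul_mem_generic S x).exists
  exact ⟨_, hε⟩

/-- Regions correspond to labeled members. -/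
theorem exists_regions_equiv {n : ℕ} (S : Fin n → Shape) :
    ∃ Φ : regions (markArrangement S) ≃ labeledMembers S,
      ∀ (R : regions (markArrangement S)), ∀ x ∈ R.1, (Φ R).1 = orderAt S x := by
  rw [regions, compl_markArrangement]
  set G := generic (fun j => (S j).offsets) with hG
  let p : {R | ∃ x ∈ G, R = connectedComponentIn G x} → Fin n → ℝ := fun R => R.2.choose
  have hp : ∀ R, p R ∈ G := fun R => R.2.choose_spec.1
  have hpR : ∀ R, R.1 = connectedComponentIn G (p R) := fun R => R.2.choose_spec.2
  have hw : ∀ R, ∀ x ∈ R.1, orderAt S (p R) = orderAt S x := by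
    intro R x hx
    rw [hpR] at hx
    have := (mem_connectedComponentIn_generic_iff (hp R)).1 hx
    exact (orderAt_eq_iff S (hp R) this.1).2 this.2
  refine ⟨Equiv.ofBijective (fun R => ⟨orderAt S (p R), _, rfl⟩) ⟨?_, ?_⟩, hw⟩
  · intro R R' h
    have h1 : orderAt S (p R) = orderAt S (p R') := congrArg Subtype.val h
    refine Subtype.ext ?_
    rw [hpR R, hpR R', connectedComponentIn_generic_eq_iff (hp R) (hp R')]
    exact (orderAt_eq_iff S (hp R) (hp R')).1 h1
  · rintro ⟨_, x, rfl⟩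
    obtain ⟨y, hy, hyx⟩ := exists_mem_generic_orderAt_eq S x
    exact ⟨⟨_, y, hy, rfl⟩, Subtype.ext ((hw _ y (mem_connectedComponentIn hy)).trans hyx)⟩

/-! Closure under relabeling forces all intervals to be marked in the same way -/

/-- Indices start at 0. Reads off from a table entry whether the `k`-th offset is below a given
difference. -/
theorem lt_card_filter_lt_iff {L : Finset ℝ} {K : ℕ} (h : L.card = K) (k : Fin K) (t : ℝ) :
    (k : ℕ) < (L.filter (· < t)).card ↔ L.orderEmbOfFin h k < t := by
  constructor
  · intro hk
    by_contra hle
    have hsub : L.filter (· < t) ⊆ (Finset.Iio k).map (L.orderEmbOfFin h).toEmbedding := by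
      intro l hl
      obtain ⟨hl, hlt⟩ := Finset.mem_filter.1 hl
      rw [← Finset.mem_coe, ← Finset.range_orderEmbOfFin L h] at hl
      obtain ⟨i, rfl⟩ := hl
      refine Finset.mem_map_of_mem _ (Finset.mem_Iio.2 ?_)
      exact (L.orderEmbOfFin h).lt_iff_lt.1 (lt_of_lt_of_le hlt (not_lt.1 hle))
    have := Finset.card_le_card hsub
    rw [Finset.card_map, Fin.card_Iio] at this
    omega
  · intro hlt
    have hsub : (Finset.Iic k).map (L.orderEmbOfFin h).toEmbedding ⊆ L.filter (· < t) := by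
      intro l hl
      obtain ⟨i, hi, rfl⟩ := Finset.mem_map.1 hl
      exact Finset.mem_filter.2 ⟨Finset.orderEmbOfFin_mem L h i,
        lt_of_le_of_lt ((L.orderEmbOfFin h).monotone (Finset.mem_Iic.1 hi)) hlt⟩
    have := Finset.card_le_card hsub
    rw [Finset.card_map, Fin.card_Iic] at this
    omega

theorem card_offsets_le_of_relabel_mem {n : ℕ} {S : Fin n → Shape}
    (hS : ∀ w ∈ labeledMembers S, ∀ σ, relabel σ w ∈ labeledMembers S) (i j : Fin n) :
    (S i).offsets.card ≤ (S j).offsets.card := by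
  by_cases hij : i = j
  · rw [hij]
  -- Interval `j` is placed beyond the end of interval `i`, so entry `(i, j)` counts all marks of
  -- `i`; after the swap it must be realized by the marks of `j`.
  obtain ⟨y, hy⟩ := hS _ ⟨Pi.single j ((S i).length + 1), rfl⟩ (Equiv.swap i j)
  have h1 := congrFun (congrFun hy j) i
  simp only [relabel, Equiv.swap_apply_left, Equiv.swap_apply_right] at h1
  rw [orderAt_apply, orderAt_apply, Finset.filter_true_of_mem (s := (S i).offsets)] at h1
  · rw [← h1]
    exact Finset.card_filter_le _ _
  · intro l hl
    have := ((S i).offsets_mem l hl).2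
    simp only [Pi.single_eq_same, Pi.single_eq_of_ne hij]
    linarith

theorem offsets_eq_of_relabel_mem {n : ℕ} (hn : 4 ≤ n) {S : Fin n → Shape}
    (hS : ∀ w ∈ labeledMembers S, ∀ σ, relabel σ w ∈ labeledMembers S) (i j : Fin n) :
    (S i).offsets = (S j).offsets := by
  classical
  have hcard : ∀ a, (S a).offsets.card = (S i).offsets.card := fun a =>
    le_antisymm (card_offsets_le_of_relabel_mem hS a i) (card_offsets_le_of_relabel_mem hS i a)
  let g : ∀ a, Fin (S i).offsets.card ↪o ℝ := fun a => (S a).offsets.orderEmbOfFin (hcard a)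
  have hlt : ∀ (x : Fin n → ℝ) a b (k : Fin (S i).offsets.card),
      (k : ℕ) < orderAt S x a b ↔ g a k < x b - x a := by
    intro x a b k
    rw [orderAt_apply]
    exact lt_card_filter_lt_iff (hcard a) k _
  have key : ∀ c m k, g c k ≤ g m k := by
    intro c m k
    by_contra hgt
    have hgt := not_le.1 hgt
    have hcm : c ≠ m := by rintro rfl; exact hgt.false
    obtain ⟨a, ha⟩ : ∃ a, a ∉ ({c, m} : Finset (Fin n)) := by
      by_contra! h
      have := Finset.card_le_card (Finset.eq_univ_iff_forall.2 h).ge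
      have := this.trans Finset.card_le_two
      simp at this; omega
    obtain ⟨b, hb⟩ : ∃ b, b ∉ ({c, m, a} : Finset (Fin n)) := by
      by_contra! h
      have := Finset.card_le_card (Finset.eq_univ_iff_forall.2 h).ge
      have := this.trans Finset.card_le_three
      simp at this; omega
    simp only [Finset.mem_insert, Finset.mem_singleton, not_or] at ha hb
    obtain ⟨hac, ham⟩ := ha
    obtain ⟨hbc, hbm, hba⟩ := hb
    -- Here the `k`-th mark of `a` falls on the left endpoint of `c`, and that of `c` on the left
    -- endpoint of `b`, so neither is counted; yet the `k`-th mark of `a` is before `m`, and that of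
    -- `m` is before `b`. With `c` and `m` swapped, going from `a` to `b` via `c` needs more than `g
    -- a k + g c k`, while via `m` it allows at most `g a k + g m k`, contradicting `g m k < g c k`.
    let x : Fin n → ℝ := fun t =>
      if t = m then (g c k - g m k) / 2 else if t = a then -g a k else if t = b then g c k else 0
    have hxm : x m = (g c k - g m k) / 2 := if_pos rfl
    have hxa : x a = -g a k := by simp [x, ham]
    have hxb : x b = g c k := by simp [x, hbm, hba]
    have hxc : x c = 0 := by simp [x, hcm, Ne.symm hac, Ne.symm hbc]
    obtain ⟨y, hy⟩ := hS _ ⟨x, rfl⟩ (Equiv.swap c m)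
    have htr : ∀ s t, g s k < y t - y s ↔
        g (Equiv.swap c m s) k < x (Equiv.swap c m t) - x (Equiv.swap c m s) := by
      intro s t
      rw [← hlt, ← hlt, hy]
      rfl
    have h1 := htr a c
    have h2 := htr c b
    have h3 := htr a m
    have h4 := htr m b
    rw [Equiv.swap_apply_of_ne_of_ne hac ham] at h1 h3
    rw [Equiv.swap_apply_of_ne_of_ne hbc hbm] at h2 h4
    rw [Equiv.swap_apply_left] at h1 h2
    rw [Equiv.swap_apply_right] at h3 h4
    rw [hxa] at h1 h3
    rw [hxb] at h2 h4
    rw [hxm] at h1 h2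
    rw [hxc] at h3 h4
    have e1 := h1.2 (by linarith)
    have e2 := h2.2 (by linarith)
    have e3 := not_lt.1 (mt h3.1 (by linarith))
    have e4 := not_lt.1 (mt h4.1 (by linarith))
    linarith
  have hg : g i = g j := RelEmbedding.ext fun k => le_antisymm (key i j k) (key j i k)
  have h1 := Finset.range_orderEmbOfFin (S i).offsets (hcard i)
  have h2 := Finset.range_orderEmbOfFin (S j).offsets (hcard j)
  rw [← Finset.coe_inj, ← h1, ← h2]
  exact congrArg (fun f : Fin (S i).offsets.card ↪o ℝ => Set.range f) hg

/-- Intervals `0` and `i` are compared inside the first `i + 4`, which leaves room for the two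
auxiliary ones. -/
theorem RelabelingClosed.offsets_eq {S : ℕ → Shape}
    (h : RelabelingClosed fun n => labeledMembers (firstShapes S n)) (i : ℕ) :
    (S i).offsets = (S 0).offsets :=
  offsets_eq_of_relabel_mem (n := i + 4) (by omega) (S := firstShapes S (i + 4))
    (h (i + 4)) ⟨i, by omega⟩ ⟨0, by omega⟩

/-! Intervals that are all marked in the same way -/

section Uniform

variable {n : ℕ} {S : Fin n → Shape} {L : Finset ℝ}

theorem orderAt_comp_perm (hS : ∀ j, (S j).offsets = L) (x : Fin n → ℝ)
    (σ : Equiv.Perm (Fin n)) : orderAt S (x ∘ σ) = relabel σ (orderAt S x) := by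
  funext a b
  simp [relabel, orderAt_apply, hS]

theorem orderAt_columns_mono (S : Fin n → Shape) {x : Fin n → ℝ} (hx : Monotone x) {a b : Fin n}
    (hab : a ≤ b) (k : Fin n) : orderAt S x k a ≤ orderAt S x k b := by
  rw [orderAt_apply, orderAt_apply]
  refine Finset.card_le_card (Finset.monotone_filter_right _ fun l _ hl => ?_)
  exact lt_of_lt_of_le hl (sub_le_sub_right (hx hab) _)

theorem orderAt_rows_anti (hS : ∀ j, (S j).offsets = L) {x : Fin n → ℝ} (hx : Monotone x)
    {a b : Fin n} (hab : a ≤ b) (k : Fin n) : orderAt S x b k ≤ orderAt S x a k := by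
  rw [orderAt_apply, orderAt_apply, hS, hS]
  refine Finset.card_le_card (Finset.monotone_filter_right _ fun l _ hl => ?_)
  exact lt_of_lt_of_le hl (sub_le_sub_left (hx hab) _)

/-- Isomorphic placements with increasing left endpoints have the same table. -/
theorem orderAt_eq_of_relabel_eq (hS : ∀ j, (S j).offsets = L) {x y : Fin n → ℝ} (hx : Monotone x)
    (hy : Monotone y) {τ : Equiv.Perm (Fin n)} (h : relabel τ (orderAt S x) = orderAt S y) :
    orderAt S x = orderAt S y := by
  have h' : ∀ a b, orderAt S x (τ a) (τ b) = orderAt S y a b := fun a b =>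
    congrFun (congrFun h a) b
  -- As left endpoints increase, column sums grow and row sums shrink, so `f z` is monotone for the
  -- product order with the second factor reversed. Then `f x ∘ τ = f y` and `f x` are two monotone
  -- rearrangements of the same tuple, hence equal; comparability turns equal sums into equal
  -- columns and rows.
  let f : (Fin n → ℝ) → Fin n → ℕ × ℕᵒᵈ := fun z a =>
    (∑ k, orderAt S z k a, OrderDual.toDual (∑ k, orderAt S z a k))
  have hf : ∀ {z : Fin n → ℝ}, Monotone z → Monotone (f z) := fun hz a b hab =>
    Prod.mk_le_mk.2 ⟨Finset.sum_le_sum fun k _ => orderAt_columns_mono S hz hab k,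
      OrderDual.toDual_le_toDual.2 (Finset.sum_le_sum fun k _ => orderAt_rows_anti hS hz hab k)⟩
  have hfτ : f x ∘ τ = f y := by
    funext a
    refine Prod.ext ?_ (congrArg OrderDual.toDual ?_)
    · change ∑ k, orderAt S x k (τ a) = ∑ k, orderAt S y k a
      rw [← Equiv.sum_comp τ]
      simp [h']
    · rw [← Equiv.sum_comp τ]
      simp [h']
  have hfx : f x ∘ τ = f x ∘ (1 : Equiv.Perm (Fin n)) :=
    Tuple.unique_monotone (hfτ ▸ hf hy) (hf hx)
  have hcol : ∀ k a, orderAt S x k (τ a) = orderAt S x k a := fun k a =>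
    forall_eq_of_sum_eq ((le_total (τ a) a).imp (fun hle => orderAt_columns_mono S hx hle)
      fun hle => orderAt_columns_mono S hx hle) (congrArg Prod.fst (congrFun hfx a)) k
  have hrow : ∀ k a, orderAt S x (τ a) k = orderAt S x a k := fun k a =>
    forall_eq_of_sum_eq ((le_total a (τ a)).imp (fun hle => orderAt_rows_anti hS hx hle)
      fun hle => orderAt_rows_anti hS hx hle)
      (congrArg (fun p => OrderDual.ofDual p.2) (congrFun hfx a)) k
  funext a b
  rw [← h', hcol, hrow]

-- Contraction by `1 - ε` makes the point generic and keeps it increasing since `ε < 1`; adding a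
-- small `δ * i` then breaks ties without leaving the region.
open Filter Topology in
theorem exists_strictMono_orderAt_eq (S : Fin n → Shape) {x : Fin n → ℝ} (hx : Monotone x) :
    ∃ y, StrictMono y ∧ y ∈ generic (fun j => (S j).offsets) ∧ orderAt S y = orderAt S x := by
  obtain ⟨ε, ⟨hgen, hord⟩, hε⟩ := ((eventually_smul_mem_generic S x).and
    (Ioo_mem_nhdsGT (zero_lt_one' ℝ))).exists
  have hmono : Monotone ((1 - ε) • x) := fun a b hab =>
    mul_le_mul_of_nonneg_left (hx hab) (sub_nonneg.2 hε.2.le)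
  have ht : Tendsto (fun δ : ℝ => (1 - ε) • x + fun i : Fin n => δ * (i : ℝ)) (𝓝[>] 0)
      (𝓝 ((1 - ε) • x)) := by
    have : Tendsto (fun δ : ℝ => (1 - ε) • x + fun i : Fin n => δ * (i : ℝ)) (𝓝 0)
        (𝓝 ((1 - ε) • x + fun i : Fin n => 0 * (i : ℝ))) :=
      Continuous.tendsto (by fun_prop) 0
    simp only [zero_mul] at this
    rw [show (fun _ : Fin n => (0 : ℝ)) = 0 from rfl, add_zero] at this
    exact this.mono_left nhdsWithin_le_nhds
  obtain ⟨δ, ⟨hg, hs⟩, hδ⟩ := ((ht.eventually (eventually_mem_generic hgen)).and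
    self_mem_nhdsWithin).exists
  refine ⟨_, fun a b hab => ?_, hg, ((orderAt_eq_iff S hg hgen).2 hs.symm).trans hord⟩
  have h1 := hmono hab.le
  have h2 : δ * (a : ℝ) < δ * (b : ℝ) :=
    mul_lt_mul_of_pos_left (by exact_mod_cast hab) (Set.mem_Ioi.1 hδ)
  simp only [Pi.add_apply]
  linarith

theorem exists_strictMono_unlabel_eq (hS : ∀ j, (S j).offsets = L) {w : Fin n → Fin n → ℕ}
    (hw : w ∈ labeledMembers S) :
    ∃ y, StrictMono y ∧ y ∈ generic (fun _ => insert 0 L) ∧ unlabel (orderAt S y) = unlabel w := by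
  obtain ⟨x, rfl⟩ := hw
  obtain ⟨y, hy, hg, ho⟩ := exists_strictMono_orderAt_eq S (Tuple.monotone_sort x)
  refine ⟨y, hy, fun i j hij l hl => ?_, ?_⟩
  · rcases Finset.mem_insert.1 hl with rfl | hl
    · exact sub_ne_zero.2 (hy.injective.ne hij)
    · exact hg i j hij l (by simpa [hS] using hl)
  · rw [ho, orderAt_comp_perm hS]
    exact (Quotient.sound ⟨Tuple.sort x, rfl⟩ : unlabel (orderAt S x) = _).symm

/-- The offset `0` records the relative order of the coordinates, so `σ ∘ τ⁻¹` is increasing and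
therefore the identity. -/
theorem perm_eq_of_sameSide {x : Fin n → ℝ} (hx : StrictMono x) {σ τ : Equiv.Perm (Fin n)}
    (h : SameSide (fun _ => insert 0 L) (x ∘ σ) (x ∘ τ)) : σ = τ := by
  have hlt : ∀ i j, τ i < τ j → σ i < σ j := by
    intro i j hij
    have hne : i ≠ j := by rintro rfl; exact hij.false
    have := (h i j hne 0 (Finset.mem_insert_self _ _)).2 (sub_neg.2 (hx hij))
    exact hx.lt_iff_lt.1 (sub_neg.1 this)
  have h1 : Monotone (⇑σ ∘ ⇑σ⁻¹) := fun a b hab => by simpa using hab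
  have h2 : Monotone (⇑σ ∘ ⇑τ⁻¹) :=
    StrictMono.monotone fun a b hab => hlt _ _ (by simpa using hab)
  have h3 := Tuple.unique_monotone h1 h2
  ext a
  have h4 : τ a = σ a := by simpa using congrFun h3 (τ a)
  rw [h4]

theorem generic_offsets_of_insert {x : Fin n → ℝ} (hS : ∀ j, (S j).offsets = L)
    (hx : x ∈ generic (fun _ => insert 0 L)) : x ∈ generic (fun j => (S j).offsets) :=
  fun i j hij l hl => hx i j hij l (Finset.mem_insert_of_mem (by simpa [hS] using hl))

theorem orderAt_eq_of_sameSide_insert (hS : ∀ j, (S j).offsets = L) {x y : Fin n → ℝ}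
    (hx : x ∈ generic (fun _ => insert 0 L)) (hy : y ∈ generic (fun _ => insert 0 L))
    (h : SameSide (fun _ => insert 0 L) x y) : orderAt S x = orderAt S y :=
  (orderAt_eq_iff S (generic_offsets_of_insert hS hx) (generic_offsets_of_insert hS hy)).2
    fun i j hij l hl => h i j hij l (Finset.mem_insert_of_mem (by simpa [hS] using hl))

/-- A generic placement isomorphic to one with increasing left endpoints lies in the region of a
rearrangement of the latter. -/
theorem exists_perm_sameSide (hS : ∀ j, (S j).offsets = L) {x y : Fin n → ℝ} (hy : StrictMono y)
    (hyg : y ∈ generic (fun _ => insert 0 L)) (hxg : x ∈ generic (fun _ => insert 0 L))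
    (h : unlabel (orderAt S x) = unlabel (orderAt S y)) :
    ∃ σ : Equiv.Perm (Fin n), SameSide (fun _ => insert 0 L) (y ∘ σ) x := by
  obtain ⟨ρ, hρ⟩ := Quotient.exact h
  set π := Tuple.sort x
  have hπ : Monotone (x ∘ π) := Tuple.monotone_sort x
  have hinj : Function.Injective x := fun i j hij => by
    by_contra hne
    exact hxg i j hne 0 (Finset.mem_insert_self _ _) (sub_eq_zero.2 hij)
  have hπs : StrictMono (x ∘ π) := hπ.strictMono_of_injective (hinj.comp π.injective)
  have heq : orderAt S (x ∘ π) = orderAt S y := by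
    refine orderAt_eq_of_relabel_eq hS hπ hy.monotone (τ := π⁻¹ * ρ) ?_
    rw [orderAt_comp_perm hS, ← hρ]
    funext a b
    simp [relabel]
  have hside : SameSide (fun _ => insert 0 L) y (x ∘ π) := by
    have h1 := (orderAt_eq_iff S (generic_offsets_of_insert hS hyg)
      (generic_offsets_of_insert hS (generic_comp_perm hxg π))).1 heq.symm
    intro i j hij l hl
    rcases Finset.mem_insert.1 hl with rfl | hl
    -- The table does not see the braid hyperplanes; there the sides agree because both points are
    -- strictly increasing.
    · rw [sub_neg, sub_neg, hy.lt_iff_lt, hπs.lt_iff_lt]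
    · exact h1 i j hij l (by simpa [hS] using hl)
  refine ⟨π⁻¹, ?_⟩
  have := hside.comp_perm π⁻¹
  rwa [show (x ∘ ⇑π) ∘ ⇑π⁻¹ = x by funext a; simp] at this

/-- Unlabeled members correspond, with multiplicity `n!`, to regions. -/
theorem exists_regions_unlabel (hS : ∀ j, (S j).offsets = L) :
    ∃ Ψ : regions (markArrangement S ∪ braidArrangement n) →
        (unlabel '' labeledMembers S : Set (Quotient (isoSetoid n))),
      (∀ R, ∀ x ∈ R.1, (Ψ R).1 = unlabel (orderAt S x)) ∧
      ∀ u, Nat.card {R // Ψ R = u} = n.factorial := by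
  rw [regions, compl_markArrangement_union_braidArrangement,
    show (fun j => insert 0 (S j).offsets) = fun _ => insert 0 L from funext fun j => by rw [hS j]]
  set G := generic (n := n) (fun _ => insert 0 L) with hG
  let p : {R | ∃ x ∈ G, R = connectedComponentIn G x} → Fin n → ℝ := fun R => R.2.choose
  have hp : ∀ R, p R ∈ G := fun R => R.2.choose_spec.1
  have hpR : ∀ R, R.1 = connectedComponentIn G (p R) := fun R => R.2.choose_spec.2
  have hw : ∀ R, ∀ x ∈ R.1, unlabel (orderAt S (p R)) = unlabel (orderAt S x) := by
    intro R x hx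
    rw [hpR] at hx
    have := (mem_connectedComponentIn_generic_iff (hp R)).1 hx
    rw [orderAt_eq_of_sameSide_insert hS (hp R) this.1 this.2]
  refine ⟨fun R => ⟨unlabel (orderAt S (p R)), _, ⟨_, rfl⟩, rfl⟩, hw, ?_⟩
  rintro ⟨_, w, hwS, rfl⟩
  obtain ⟨y, hy, hyg, hyw⟩ := exists_strictMono_unlabel_eq hS hwS
  have hyσ : ∀ σ : Equiv.Perm (Fin n), y ∘ σ ∈ G := generic_comp_perm hyg
  rw [show n.factorial = Nat.card (Equiv.Perm (Fin n)) by
    rw [Nat.card_eq_fintype_card, Fintype.card_perm, Fintype.card_fin]]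
  symm
  -- The fibre consists of the regions of the points `y ∘ σ`, for one increasing representative `y`.
  refine Nat.card_congr (Equiv.ofBijective
    (fun σ => ⟨⟨connectedComponentIn G (y ∘ σ), _, hyσ σ, rfl⟩, Subtype.ext ?_⟩) ⟨?_, ?_⟩)
  · refine (hw _ _ (mem_connectedComponentIn (hyσ σ))).trans ?_
    rw [orderAt_comp_perm hS]
    exact (Quotient.sound ⟨σ, rfl⟩ : unlabel (orderAt S y) = _).symm.trans hyw
  · intro σ τ h
    have h1 : connectedComponentIn G (y ∘ σ) = connectedComponentIn G (y ∘ τ) :=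
      congrArg (fun R => R.1.1) h
    exact perm_eq_of_sameSide hy ((connectedComponentIn_generic_eq_iff (hyσ σ) (hyσ τ)).1 h1)
  · rintro ⟨R, hR⟩
    have h1 : unlabel (orderAt S (p R)) = unlabel w := congrArg Subtype.val hR
    obtain ⟨σ, hσ⟩ := exists_perm_sameSide hS hy hyg (hp R) (h1.trans hyw.symm)
    refine ⟨σ, Subtype.ext (Subtype.ext ?_)⟩
    change connectedComponentIn G (y ∘ σ) = R.1
    rw [hpR R, connectedComponentIn_generic_eq_iff (hyσ σ) (hp R)]
    exact hσ

end Uniform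

/-! ### Identically marked intervals form a garden -/

theorem isGarden_labeledMembers {S : ℕ → Shape} {L : Finset ℝ} (hS : ∀ j, (S j).offsets = L) :
    IsGarden fun n => labeledMembers (firstShapes S n) := by
  have hS' : ∀ n j, (firstShapes S n j).offsets = L := fun n j => hS j
  constructor
  · rintro n _ ⟨x, rfl⟩ σ
    exact ⟨_, orderAt_comp_perm (hS' n) x σ⟩
  · intro n w i j hij hw
    constructor
    · rintro ⟨x, rfl⟩
      refine ⟨x ∘ i.succAbove, ?_⟩
      funext a b
      simp [remove, orderAt_apply, hS']
    · rintro ⟨y, hy⟩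
      obtain ⟨j', rfl⟩ := Fin.exists_succAbove_eq hij.symm
      -- `r` sends `i` to its clone and is the identity on the rest, so the placement `y ∘ r` puts
      -- the new interval exactly on top of its clone.
      let r : Fin (n + 1) → Fin n := i.insertNth j' id
      have hrow : ∀ a b, w (i.succAbove (r a)) b = w a b := by
        intro a b
        refine Fin.succAboveCases i ?_ (fun a => ?_) a
        · simp [r, (hw.2.2 b).1]
        · simp [r]
      have hcol : ∀ a b, w a (i.succAbove (r b)) = w a b := by
        intro a b
        refine Fin.succAboveCases i ?_ (fun b => ?_) b
        · simp [r, (hw.2.2 a).2]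
        · simp [r]
      refine ⟨y ∘ r, ?_⟩
      funext a b
      rw [← hrow a b, ← hcol _ b]
      have := congrFun (congrFun hy (r a)) (r b)
      rw [remove] at this
      rw [← this, orderAt_apply, orderAt_apply, hS', hS']
      rfl

end MarkedIntervalOrder

theorem mainTheorem11 :
    -- labeled members correspond to regions, each interval having its own marks
    (∀ (n : ℕ) (S : Fin n → Shape),
      (labeledMembers S).Finite ∧
      ∃ Φ : regions (markArrangement S) ≃ labeledMembers S,
        ∀ (R : regions (markArrangement S)), ∀ x ∈ R.1, (Φ R).1 = orderAt S x) ∧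
    -- unlabeled members correspond, with multiplicity `n!`, to regions of the union with the
    -- braid arrangement, and the generating functions are related by the substitution
    (∀ S : ℕ → Shape, RelabelingClosed (fun n => labeledMembers (firstShapes S n)) →
      (∀ n : ℕ,
        ∃ Ψ : regions (markArrangement (firstShapes S n) ∪ braidArrangement n) →
            (unlabel '' labeledMembers (firstShapes S n) : Set (Quotient (isoSetoid n))),
          (∀ R, ∀ x ∈ R.1, (Ψ R).1 = unlabel (orderAt (firstShapes S n) x)) ∧
          ∀ u, Nat.card {R // Ψ R = u} = n.factorial) ∧
      egf (fun n => labeledMembers (firstShapes S n)) =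
        (ogf (fun n => labeledMembers (firstShapes S n))).subst oneSubExpNeg) ∧
    -- the generating functions of an arbitrary garden of marked interval orders
    (∀ O : (n : ℕ) → Set (Fin n → Fin n → ℕ),
      (∀ n, (O n).Finite) → (∀ n, ∀ w ∈ O n, IsMarkedIntervalOrder w) → IsGarden O →
      egf O = (ogf O).subst oneSubExpNeg) := by
  refine ⟨fun n S => ⟨finite_labeledMembers S, exists_regions_equiv S⟩, fun S hS => ?_,
    fun O hfin hreal hO => hO.egf_eq hfin hreal⟩
  exact ⟨fun n => exists_regions_unlabel fun j => hS.offsets_eq j,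
    (isGarden_labeledMembers hS.offsets_eq).egf_eq (fun n => finite_labeledMembers _)
      fun n w => isMarkedIntervalOrder_of_mem⟩
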